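/- Let $r,n\ge 1$ be integers, $q$ an indeterminate, $\xi=e^{2\pi i/r}$, $\Delta=\prod_{0\le i<j\le r-1}(\xi^i-\xi^j)$ and $R=\mathbb Z[q,q^{-1},\xi,r^{-1},\Delta^{-1}]$. The Yokonuma--Hecke algebra $\mathcal Y_{r,n}(q)$ is the associative unital $R$-algebra with generators $g_1,\dots,g_{n-1},t_1,\dots,t_n$ and relations $t_i^r=1$; $t_it_j=t_jt_i$; $t_jg_i=g_it_{js_i}$ with $s_i=(i,i+1)$; $g_ig_j=g_jg_i$ if $|i-j|>1$; $g_ig_{i+1}g_i=g_{i+1}g_ig_{i+1}$; and $g_i^2=1+(q-q^{-1})e_ig_i$, where $e_i=\frac1r\sum_{s=0}^{r-1}t_i^st_{i+1}^{-s}$. For a commutative ring $A$, a unit $q\in A^\times$ and an element $\xi\in A$, let $V_A$ be the free $A$-module with basis $\{v_i^t\mid 1\le i\le n,\ 0\le t\le r-1\}$. Writing operators on the right, define $\mathbf T\in\mathrm{End}_A(V_A)$ by $(v_i^t)\mathbf T=\xi^tv_i^t$ and $\mathbf G\in\mathrm{End}_A(V_A^{\otimes2})$ by $$(v_i^t\otimes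 v_j^s)\mathbf G=\begin{cases}v_j^s\otimes v_i^t&\text{if }t\ne s,\\ q\,v_i^t\otimes v_j^s&\text{if }t=s,\ i=j,\\ v_j^s\otimes v_i^t&\text{if }t=s,\ i>j,\\ (q-q^{-1})\,v_i^t\otimes v_j^s+v_j^s\otimes v_i^t&\text{if }t=s,\ i<j.\end{cases}$$ Let $\mathbf T_i$ be $\mathbf T$ acting in the $i$-th factor of $V_A^{\otimes n}$ and $\mathbf G_i$ be $\mathbf G$ acting in the factors $i,i+1$, both as the identity in the remaining factors. **Theorem.** (1) There is a representation $\rho$ of $\mathcal Y_{r,n}(q)$ on $V_R^{\otimes n}$ (a right action, $R$-linear) with $\rho(t_i)=\mathbf T_i$ and $\rho(g_i)=\mathbf G_i$, and $\rho$ is faithful. (2) Let $\mathcal K$ be a commutative ring with elements $q,\xi\in\mathcal K^\times$ such that $\xi^r=1$ and such that $r$ and $\prod_{0\le i<j\le r-1}(\xi^i-\xi^j)$ are invertible in $\mathcal K$. Then there is a unique ring homomorphism $R\to\mathcal K$ with $q\mapsto q$ and $\xi\mapsto\xi$. For the resulting specialized algebra $\mathcal Y^{\mathcal K}_{r,n}(q)=\mathcal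 K\otimes_R\mathcal Y_{r,n}(q)$ there is a $\mathcal K$-linear representation $\rho^{\mathcal K}$ on $V_{\mathcal K}^{\otimes n}$ with $\rho^{\mathcal K}(1\otimes t_i)=\mathbf T_i$ and $\rho^{\mathcal K}(1\otimes g_i)=\mathbf G_i$, and $\rho^{\mathcal K}$ is faithful. -/

import Mathlib

open scoped TensorProduct

noncomputable section

namespace YokonumaHecke

/-! ### The ground ring `R = ℤ[q, q⁻¹, ξ, r⁻¹, Δ⁻¹]` -/

/-- The Vandermonde product `∏_{0 ≤ i < j ≤ r-1} (x ^ i - x ^ j)`. -/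
def vandermonde {A : Type*} [CommRing A] (r : ℕ) (x : A) : A :=
  ∏ j ∈ Finset.range r, ∏ i ∈ Finset.range j, (x ^ i - x ^ j)

/-- The complex number `exp (2 π i / r)`. -/
def xiComplex (r : ℕ) : ℂ :=
  Complex.exp (2 * Real.pi * Complex.I / r)

/-- The subring `ℤ[ξ, r⁻¹, Δ⁻¹]` of `ℂ`. -/
abbrev CoeffRing (r : ℕ) : Subalgebra ℤ ℂ :=
  Algebra.adjoin ℤ {xiComplex r, (r : ℂ)⁻¹, (vandermonde r (xiComplex r))⁻¹}

/-- The ring `R = ℤ[q, q⁻¹, ξ, r⁻¹, Δ⁻¹]`, where `q` is an indeterminate. -/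
abbrev BaseRing (r : ℕ) : Type :=
  LaurentPolynomial (CoeffRing r)

/-- The indeterminate `q`, as a unit of `R`. -/
def qBase (r : ℕ) : (BaseRing r)ˣ where
  val := LaurentPolynomial.T 1
  inv := LaurentPolynomial.T (-1)
  val_inv := by rw [← LaurentPolynomial.T_add]; simp
  inv_val := by rw [← LaurentPolynomial.T_add]; simp

/-- The root of unity `ξ` in `R`. -/
def xiBase (r : ℕ) : BaseRing r :=
  LaurentPolynomial.C ⟨xiComplex r, Algebra.subset_adjoin (by simp)⟩

/-- The element `r⁻¹` of `R`. -/
def rInvBase (r : ℕ) : BaseRing r :=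
  LaurentPolynomial.C ⟨(r : ℂ)⁻¹, Algebra.subset_adjoin (by simp)⟩

/-! ### The Yokonuma-Hecke algebra -/

/-- The position `i` in `{1, …, n}`, for `i` in `{1, …, n - 1}` (both sets are counted from `0`). -/
def lo {n : ℕ} (i : Fin (n - 1)) : Fin n := ⟨i, by omega⟩

/-- The position `i + 1` in `{1, …, n}`, for `i` in `{1, …, n - 1}`. -/
def hi {n : ℕ} (i : Fin (n - 1)) : Fin n := ⟨i + 1, by omega⟩

theorem lo_ne_hi {n : ℕ} (i : Fin (n - 1)) : lo i ≠ hi i := by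
  simp [lo, hi, Fin.ext_iff]

/-- The generators `g_1, …, g_{n-1}` and `t_1, …, t_n`. -/
inductive Gen (n : ℕ) : Type
  | g (i : Fin (n - 1)) : Gen n
  | t (j : Fin n) : Gen n

section Free

variable (r n : ℕ)

/-- The free generator `g_i`. -/
def freeG (i : Fin (n - 1)) : FreeAlgebra (BaseRing r) (Gen n) :=
  FreeAlgebra.ι (BaseRing r) (Gen.g i)

/-- The free generator `t_j`. -/
def freeT (j : Fin n) : FreeAlgebra (BaseRing r) (Gen n) :=
  FreeAlgebra.ι (BaseRing r) (Gen.t j)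

/-- `e_i = r⁻¹ ∑_{s=0}^{r-1} t_i ^ s t_{i+1} ^ (-s)`; because of the relation `t_{i+1} ^ r = 1`,
the power `t_{i+1} ^ (-s)` is written `t_{i+1} ^ (r - s)`. -/
def freeE (i : Fin (n - 1)) : FreeAlgebra (BaseRing r) (Gen n) :=
  rInvBase r • ∑ s ∈ Finset.range r, freeT r n (lo i) ^ s * freeT r n (hi i) ^ (r - s)

/-- The defining relations of the Yokonuma-Hecke algebra. -/
inductive Rel : FreeAlgebra (BaseRing r) (Gen n) → FreeAlgebra (BaseRing r) (Gen n) → Prop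
  | t_pow (i : Fin n) : Rel (freeT r n i ^ r) 1
  | t_comm (i j : Fin n) : Rel (freeT r n i * freeT r n j) (freeT r n j * freeT r n i)
  | t_g (i : Fin (n - 1)) (j : Fin n) :
      Rel (freeT r n j * freeG r n i)
        (freeG r n i * freeT r n (Equiv.swap (lo i) (hi i) j))
  | g_comm (i j : Fin (n - 1)) (hij : 1 < |((i : ℕ) : ℤ) - ((j : ℕ) : ℤ)|) :
      Rel (freeG r n i * freeG r n j) (freeG r n j * freeG r n i)
  | braid (i j : Fin (n - 1)) (hij : (j : ℕ) = (i : ℕ) + 1) :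
      Rel (freeG r n i * freeG r n j * freeG r n i) (freeG r n j * freeG r n i * freeG r n j)
  | quadratic (i : Fin (n - 1)) :
      Rel (freeG r n i ^ 2)
        (1 + ((qBase r : BaseRing r) - ((qBase r)⁻¹ : (BaseRing r)ˣ)) •
          (freeE r n i * freeG r n i))

end Free

/-- The Yokonuma-Hecke algebra `𝒴_{r,n}(q)` over `R`. -/
abbrev Yokonuma (r n : ℕ) : Type :=
  RingQuot (Rel r n)

/-- The element `g_i` of the Yokonuma-Hecke algebra. -/
def g (r n : ℕ) (i : Fin (n - 1)) : Yokonuma r n :=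
  RingQuot.mkAlgHom (BaseRing r) (Rel r n) (freeG r n i)

/-- The element `t_j` of the Yokonuma-Hecke algebra. -/
def t (r n : ℕ) (j : Fin n) : Yokonuma r n :=
  RingQuot.mkAlgHom (BaseRing r) (Rel r n) (freeT r n j)

/-! ### Tensor space -/

section Tensor

variable (A : Type*) [CommRing A] (r n : ℕ)

/-- The free `A`-module `V` with basis `v_i^t`, `1 ≤ i ≤ n`, `0 ≤ t ≤ r - 1`. -/
abbrev V : Type _ := (Fin n × Fin r) →₀ A

/-- The basis of `V`; its element at `(i, t)` is `v_i^t`. -/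
def basisV : Module.Basis (Fin n × Fin r) A (V A r n) :=
  Finsupp.basisSingleOne

/-- The tensor space `V^{⊗ n}`. -/
abbrev TensorSpace : Type _ := ⨂[A] _ : Fin n, V A r n

/-- The basis of `V^{⊗ n}` that consists of the tensors of basis vectors of `V`. -/
def basisTensor : Module.Basis (Fin n → Fin n × Fin r) A (TensorSpace A r n) :=
  Basis.piTensorProduct fun _ => basisV A r n

variable {A}

/-- The operator `𝐓` on `V`, `(v_i^t) 𝐓 = ξ ^ t v_i^t`. -/
def opT (ξ : A) : Module.End A (V A r n) :=
  (basisV A r n).constr A fun x => ξ ^ (x.2 : ℕ) • basisV A r n x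

/-- The operator `𝐆` on `V ⊗ V`, given by its values on `v_i^t ⊗ v_j^s`,
where `x = (i, t)` and `y = (j, s)`. -/
def opG (q : Aˣ) : Module.End A (V A r n ⊗[A] V A r n) :=
  ((basisV A r n).tensorProduct (basisV A r n)).constr A fun p =>
    let x := p.1
    let y := p.2
    if x.2 ≠ y.2 then basisV A r n y ⊗ₜ[A] basisV A r n x
    else if x.1 = y.1 then (q : A) • (basisV A r n x ⊗ₜ[A] basisV A r n y)
    else if y.1 < x.1 then basisV A r n y ⊗ₜ[A] basisV A r n x
    else ((q : A) - (q⁻¹ : Aˣ)) • (basisV A r n x ⊗ₜ[A] basisV A r n y) +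
      basisV A r n y ⊗ₜ[A] basisV A r n x

/-- The operator `𝐓_i`: `𝐓` acting in the `i`-th factor of `V^{⊗ n}`. -/
def opTi (ξ : A) (i : Fin n) : Module.End A (TensorSpace A r n) :=
  PiTensorProduct.map (Function.update (fun _ => LinearMap.id) i (opT r n ξ))

variable {r n}

/-- The linear map `V ⊗ V → V^{⊗ n}` that sends `a ⊗ b` to the pure tensor with entries `a` and `b`
in the factors `i` and `i + 1` and with the entries of `u` in the other factors. -/
def insertPair (u : Fin n → V A r n) (i : Fin (n - 1)) :
    V A r n ⊗[A] V A r n →ₗ[A] TensorSpace A r n :=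
  TensorProduct.lift <| LinearMap.mk₂ A
    (fun a b => PiTensorProduct.tprod A
      (Function.update (Function.update u (lo i) a) (hi i) b))
    (fun a a' b => by
      simp only [Function.update_comm (lo_ne_hi i)]
      exact MultilinearMap.map_update_add _ _ _ _ _)
    (fun c a b => by
      simp only [Function.update_comm (lo_ne_hi i)]
      exact MultilinearMap.map_update_smul _ _ _ _ _)
    (fun a b b' => MultilinearMap.map_update_add _ _ _ _ _)
    (fun c a b => MultilinearMap.map_update_smul _ _ _ _ _)

/-- For an operator `F` on `V ⊗ V`, the operator on `V^{⊗ n}` which acts as `F` in the factors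
`i` and `i + 1` and as the identity in the other factors. -/
def actPair (F : Module.End A (V A r n ⊗[A] V A r n)) (i : Fin (n - 1)) :
    Module.End A (TensorSpace A r n) :=
  (basisTensor A r n).constr A fun w =>
    insertPair (fun k => basisV A r n (w k)) i
      (F (basisV A r n (w (lo i)) ⊗ₜ[A] basisV A r n (w (hi i))))

variable (r n)

/-- The operator `𝐆_i`: `𝐆` acting in the factors `i` and `i + 1` of `V^{⊗ n}`. -/
def opGi (q : Aˣ) (i : Fin (n - 1)) : Module.End A (TensorSpace A r n) :=
  actPair (opG r n q) i

end Tensor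

/-- `V^{⊗ n}` is a right module: operators are written on the right of their arguments, so that
`v (X Y) = (v X) Y`, and their algebra is the opposite of `Module.End`. -/
abbrev RightEnd (A : Type*) [CommRing A] (r n : ℕ) : Type _ :=
  (Module.End A (TensorSpace A r n))ᵐᵒᵖ

end YokonumaHecke

end

/-!
The theorem holds because the action of the algebra on tensor space has a vector with trivial
annihilator, and the inverse of its orbit map can be written down without a basis of the algebra.

On the basis tensor with the positions `σ` and the colours `d` the operator `𝐆_i` swaps two
neighbours, up to a Hecke correction that occurs only for equal colours
(`opGi_basisTensor`). All relations, including the braid relation, become identities between the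
coefficients `stayCoeff` and `swapCoeff`, so that the operators form a Yokonuma-Hecke family over
every ring that contains a separated root of unity (`isYokonumaFamily_op`).

Let `B` be any algebra generated by elements `G i`, `T j` that satisfy the relations. The `T j`
commute, and their joint eigenprojections `E d` sum up to `1` and are permuted by the `G i`
(`IsYokonumaFamily.exists_colour`). The braid relations give well-defined elements `g_σ` with
`g_σ = g_{σ s_i} G i` at every ascent `i` of `σ` (`gWord_eq_mul`, a diamond lemma argument). The
linear map `toAlgebra` from tensor space to `B` that sends the basis tensor `(σ, d)` to `g_σ E d`,
and to `0` if a position is repeated, commutes with the right actions of `B`. The sum over all `d`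
of the basis tensors `(σ, d)`, with `σ` the decreasing word, is sent to `∑ d, E d = 1`; hence
`y` is recovered from its action on this vector, and the action is faithful
(`IsYokonumaFamily.injective_of_adjoin_eq_top`). This applies to the Yokonuma-Hecke algebra and to
each of its specializations.

For the homomorphism `R → K`, the point is that `ξ ∈ K` is a root of the `r`-th cyclotomic
polynomial: its powers are separated by units, so the other cyclotomic factors of `X ^ r - 1` take
unit values. Polynomial relations for `exp (2 π i / r)` therefore carry over to `K`, and so do those
that involve the inverses of `r` and `Δ` (`exists_coeffRing_hom`).
-/

noncomputable section

namespace YokonumaHecke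

/-! ### Families that satisfy the Yokonuma-Hecke relations -/

/-- The defining relations of the Yokonuma-Hecke algebra with parameter `q`, for elements
`G i` and `T j` of an algebra `B` over an arbitrary commutative ring `A`;
the scalar `c` plays the role of `r⁻¹`. -/
structure IsYokonumaFamily {A B : Type*} [CommRing A] [Semiring B] [Algebra A B] (r : ℕ) {n : ℕ}
    (q : Aˣ) (c : A) (G : Fin (n - 1) → B) (T : Fin n → B) : Prop where
  t_pow : ∀ j, T j ^ r = 1
  t_comm : ∀ i j, T i * T j = T j * T i
  t_g : ∀ i j, T j * G i = G i * T (Equiv.swap (lo i) (hi i) j)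
  g_comm : ∀ i j : Fin (n - 1), 1 < |((i : ℕ) : ℤ) - ((j : ℕ) : ℤ)| → G i * G j = G j * G i
  braid : ∀ i j : Fin (n - 1), (j : ℕ) = (i : ℕ) + 1 → G i * G j * G i = G j * G i * G j
  quadratic : ∀ i, G i ^ 2 = 1 + ((q : A) - (q⁻¹ : Aˣ)) •
    ((c • ∑ s ∈ Finset.range r, T (lo i) ^ s * T (hi i) ^ (r - s)) * G i)

/-- The element `ξ` is an `r`-th root of unity whose powers `ξ ^ 0, …, ξ ^ (r - 1)` have
pairwise invertible differences. -/
structure IsSeparatedRoot {A : Type*} [CommRing A] (r : ℕ) (ξ : A) : Prop where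
  pow_eq_one : ξ ^ r = 1
  isUnit_sub : ∀ i j, i < r → j < r → i ≠ j → IsUnit (ξ ^ i - ξ ^ j)

section Root

variable {A : Type*} [CommRing A] {r : ℕ} {ξ : A}

theorem IsSeparatedRoot.of_isUnit_vandermonde (h : ξ ^ r = 1) (hv : IsUnit (vandermonde r ξ)) :
    IsSeparatedRoot r ξ := by
  have key : ∀ i j, i < j → j < r → IsUnit (ξ ^ i - ξ ^ j) := fun i j hij hj =>
    isUnit_of_dvd_unit ((Finset.dvd_prod_of_mem (fun i => ξ ^ i - ξ ^ j)
      (Finset.mem_range.2 hij)).trans (Finset.dvd_prod_of_mem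
        (fun j => ∏ i ∈ Finset.range j, (ξ ^ i - ξ ^ j)) (Finset.mem_range.2 hj))) hv
  refine ⟨h, fun i j hi hj hij => ?_⟩
  rcases lt_or_gt_of_ne hij with h | h
  · exact key i j h hj
  · rw [← neg_sub]
    exact (key j i h hi).neg

theorem IsSeparatedRoot.map {A' : Type*} [CommRing A'] (h : IsSeparatedRoot r ξ) (f : A →+* A') :
    IsSeparatedRoot r (f ξ) :=
  ⟨by rw [← map_pow, h.pow_eq_one, map_one], fun i j hi hj hij => by
    simpa using (h.isUnit_sub i j hi hj hij).map f⟩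

/-- Orthogonality of the characters of the cyclic group of order `r`. -/
theorem IsSeparatedRoot.sum_pow_mul_pow (h : IsSeparatedRoot r ξ) (a b : Fin r) :
    ∑ s ∈ Finset.range r, (ξ ^ (a : ℕ)) ^ s * (ξ ^ (b : ℕ)) ^ (r - s) =
      if a = b then (r : A) else 0 := by
  have hpow : ∀ k : ℕ, (ξ ^ k) ^ r = 1 := fun k => by
    rw [← pow_mul, mul_comm, pow_mul, h.pow_eq_one, one_pow]
  split_ifs with hab
  · subst hab
    rw [Finset.sum_congr rfl (g := fun _ => (1 : A))]
    · simp
    · intro s hs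
      rw [← pow_add, Nat.add_sub_cancel' (Finset.mem_range.1 hs).le, hpow]
  · have hu := h.isUnit_sub a b a.2 b.2 (fun h => hab (Fin.ext h))
    apply hu.mul_left_cancel
    have := geom_sum₂_mul (ξ ^ (a : ℕ)) (ξ ^ (b : ℕ)) r
    rw [hpow, hpow, sub_self] at this
    rw [mul_zero, ← mul_zero (ξ ^ (b : ℕ)), ← this, mul_comm, ← mul_assoc, Finset.mul_sum]
    congr 1
    refine Finset.sum_congr rfl fun s hs => ?_
    have : r - s = (r - 1 - s) + 1 := by have := Finset.mem_range.1 hs; omega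
    rw [this, pow_succ]
    ring

/-- Orthogonality of the characters of the cyclic group of order `r`, summed over the
characters. -/
theorem IsSeparatedRoot.sum_pow (h : IsSeparatedRoot r ξ) {k : ℕ} (hk : 0 < k) (hkr : k < r) :
    ∑ a : Fin r, (ξ ^ (a : ℕ)) ^ k = 0 := by
  have hu := h.isUnit_sub k 0 hkr (by omega) hk.ne'
  apply hu.mul_left_cancel
  rw [Fin.sum_univ_eq_sum_range (fun a => (ξ ^ a) ^ k) r, mul_zero, pow_zero, mul_comm]
  simp_rw [← pow_mul, mul_comm _ k, pow_mul]
  rw [geom_sum_mul, ← pow_mul, mul_comm, pow_mul, h.pow_eq_one, one_pow, sub_self]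

end Root

/-! ### The operators on tensor space -/

section Operators

variable {A : Type*} [CommRing A] {r n : ℕ}

/-- The coefficient of `x ⊗ y` in `(x ⊗ y) 𝐆`, for basis vectors `x` and `y`. -/
def stayCoeff (q : Aˣ) (x y : Fin n × Fin r) : A :=
  if x.2 ≠ y.2 then 0 else if x.1 = y.1 then (q : A) else if y.1 < x.1 then 0
  else (q : A) - (q⁻¹ : Aˣ)

/-- The coefficient of `y ⊗ x` in `(x ⊗ y) 𝐆`, for basis vectors `x` and `y`;
for `x = y` the coefficient `q` is attributed to `stayCoeff`. -/
def swapCoeff (A : Type*) [CommRing A] (x y : Fin n × Fin r) : A :=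
  if x.2 ≠ y.2 then 1 else if x.1 = y.1 then 0 else 1

theorem basisTensor_eq_tprod (w : Fin n → Fin n × Fin r) :
    basisTensor A r n w = PiTensorProduct.tprod A fun k => basisV A r n (w k) := by
  simp [basisTensor]

theorem opG_basis (q : Aˣ) (x y : Fin n × Fin r) :
    opG r n q (basisV A r n x ⊗ₜ[A] basisV A r n y) =
      stayCoeff q x y • (basisV A r n x ⊗ₜ[A] basisV A r n y) +
        swapCoeff A x y • (basisV A r n y ⊗ₜ[A] basisV A r n x) := by
  rw [← Module.Basis.tensorProduct_apply, opG, Module.Basis.constr_basis]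
  simp only [stayCoeff, swapCoeff]
  split_ifs <;> simp

theorem insertPair_basis (w : Fin n → Fin n × Fin r) (i : Fin (n - 1)) (x y : Fin n × Fin r) :
    insertPair (fun k => basisV A r n (w k)) i (basisV A r n x ⊗ₜ[A] basisV A r n y) =
      basisTensor A r n (Function.update (Function.update w (lo i) x) (hi i) y) := by
  rw [basisTensor_eq_tprod]
  simp only [insertPair, TensorProduct.lift.tmul, LinearMap.mk₂_apply]
  congr 1
  funext k
  simp only [Function.update_apply]
  split_ifs <;> rfl

theorem update_update_eq_comp_swap {X : Type*} (w : Fin n → X) (i : Fin (n - 1)) :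
    Function.update (Function.update w (lo i) (w (hi i))) (hi i) (w (lo i)) =
      w ∘ Equiv.swap (lo i) (hi i) := by
  funext k
  simp only [Function.update_apply, Function.comp, Equiv.swap_apply_def]
  have := lo_ne_hi i
  split_ifs <;> simp_all

theorem opGi_basisTensor (q : Aˣ) (i : Fin (n - 1)) (w : Fin n → Fin n × Fin r) :
    opGi r n q i (basisTensor A r n w) =
      stayCoeff q (w (lo i)) (w (hi i)) • basisTensor A r n w +
        swapCoeff A (w (lo i)) (w (hi i)) •
          basisTensor A r n (w ∘ Equiv.swap (lo i) (hi i)) := by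
  rw [opGi, actPair, Module.Basis.constr_basis, opG_basis, map_add, map_smul, map_smul,
    insertPair_basis, insertPair_basis, update_update_eq_comp_swap]
  simp

theorem opTi_basisTensor (ξ : A) (j : Fin n) (w : Fin n → Fin n × Fin r) :
    opTi r n ξ j (basisTensor A r n w) = ξ ^ ((w j).2 : ℕ) • basisTensor A r n w := by
  rw [opTi, basisTensor_eq_tprod, PiTensorProduct.map_tprod]
  have : (fun k => (Function.update (fun _ => LinearMap.id) j (opT r n ξ) :
      Fin n → Module.End A (V A r n)) k (basisV A r n (w k))) =
      Function.update (fun k => basisV A r n (w k)) j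
        (ξ ^ ((w j).2 : ℕ) • basisV A r n (w j)) := by
    funext k
    by_cases hk : k = j
    · subst hk
      simp [opT]
    · simp [hk]
  rw [this, MultilinearMap.map_update_smul, Function.update_eq_self]

theorem opTi_pow_basisTensor (ξ : A) (j : Fin n) (s : ℕ) (w : Fin n → Fin n × Fin r) :
    (opTi r n ξ j ^ s) (basisTensor A r n w) =
      (ξ ^ ((w j).2 : ℕ)) ^ s • basisTensor A r n w := by
  induction s with
  | zero => simp
  | succ s ih => rw [pow_succ', Module.End.mul_apply, ih, map_smul, opTi_basisTensor, smul_smul,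
      pow_succ]

end Operators

section Coefficients

variable {A : Type*} [CommRing A] {r n : ℕ} (q : Aˣ) (x y z : Fin n × Fin r)

/-- Coefficient of `x ⊗ y ⊗ z` in the two sides of the braid relation on `x ⊗ y ⊗ z`. -/
theorem stayCoeff_braid :
    stayCoeff q x y * stayCoeff q y z * stayCoeff q x y +
      swapCoeff A x y * stayCoeff q x z * swapCoeff A y x =
    stayCoeff q y z * stayCoeff q x y * stayCoeff q y z +
      swapCoeff A y z * stayCoeff q x z * swapCoeff A z y := by
  have hq : (q : A) * (q⁻¹ : Aˣ) = 1 := q.mul_inv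
  obtain ⟨x, a⟩ := x
  obtain ⟨y, b⟩ := y
  obtain ⟨z, c⟩ := z
  simp only [stayCoeff, swapCoeff]
  grind

/-- Coefficient of `y ⊗ x ⊗ z` in the two sides of the braid relation on `x ⊗ y ⊗ z`. -/
theorem stayCoeff_braid_left :
    stayCoeff q x y * stayCoeff q y z * swapCoeff A x y +
      swapCoeff A x y * stayCoeff q x z * stayCoeff q y x =
    stayCoeff q y z * swapCoeff A x y * stayCoeff q x z := by
  have hq : (q : A) * (q⁻¹ : Aˣ) = 1 := q.mul_inv
  obtain ⟨x, a⟩ := x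
  obtain ⟨y, b⟩ := y
  obtain ⟨z, c⟩ := z
  simp only [stayCoeff, swapCoeff]
  grind

/-- Coefficient of `x ⊗ z ⊗ y` in the two sides of the braid relation on `x ⊗ y ⊗ z`. -/
theorem stayCoeff_braid_right :
    stayCoeff q x y * swapCoeff A y z * stayCoeff q x z =
    stayCoeff q y z * stayCoeff q x y * swapCoeff A y z +
      swapCoeff A y z * stayCoeff q x z * stayCoeff q z y := by
  have hq : (q : A) * (q⁻¹ : Aˣ) = 1 := q.mul_inv
  obtain ⟨x, a⟩ := x
  obtain ⟨y, b⟩ := y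
  obtain ⟨z, c⟩ := z
  simp only [stayCoeff, swapCoeff]
  grind

/-- The quadratic relation on a pair of basis vectors of the same colour. -/
theorem stayCoeff_quadratic (hxy : x.2 = y.2) :
    stayCoeff q x y * stayCoeff q x y + swapCoeff A x y * swapCoeff A y x =
      1 + ((q : A) - (q⁻¹ : Aˣ)) * stayCoeff q x y := by
  have hq : (q : A) * (q⁻¹ : Aˣ) = 1 := q.mul_inv
  obtain ⟨x, a⟩ := x
  obtain ⟨y, b⟩ := y
  simp only [stayCoeff, swapCoeff]
  grind

theorem stayCoeff_quadratic_swap (hxy : x.2 = y.2) :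
    stayCoeff q x y * swapCoeff A x y + swapCoeff A x y * stayCoeff q y x =
      ((q : A) - (q⁻¹ : Aˣ)) * swapCoeff A x y := by
  obtain ⟨x, a⟩ := x
  obtain ⟨y, b⟩ := y
  simp only [stayCoeff, swapCoeff]
  grind

theorem stayCoeff_of_ne (hxy : x.2 ≠ y.2) : stayCoeff q x y = 0 := by
  simp [stayCoeff, hxy]

theorem swapCoeff_of_ne (hxy : x.2 ≠ y.2) : swapCoeff A x y = 1 := by
  simp [swapCoeff, hxy]

end Coefficients

/-! ### The operators satisfy the Yokonuma-Hecke relations -/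

section Swaps

variable {n : ℕ}

theorem hi_eq_lo_of_succ {i j : Fin (n - 1)} (hij : (j : ℕ) = (i : ℕ) + 1) : hi i = lo j := by
  simp [lo, hi, hij]

theorem lo_ne_hi_of_succ {i j : Fin (n - 1)} (hij : (j : ℕ) = (i : ℕ) + 1) : lo i ≠ hi j := by
  simp only [lo, hi, ne_eq, Fin.mk.injEq]
  omega

theorem ne_of_one_lt_abs {i j : Fin (n - 1)} (hij : 1 < |((i : ℕ) : ℤ) - ((j : ℕ) : ℤ)|) :
    lo i ≠ lo j ∧ lo i ≠ hi j ∧ hi i ≠ lo j ∧ hi i ≠ hi j := by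
  simp only [lo, hi, ne_eq, Fin.mk.injEq]
  rw [lt_abs] at hij
  omega

theorem swap_comm_of_one_lt_abs {X : Type*} {i j : Fin (n - 1)}
    (hij : 1 < |((i : ℕ) : ℤ) - ((j : ℕ) : ℤ)|) (w : Fin n → X) :
    (w ∘ Equiv.swap (lo i) (hi i)) ∘ Equiv.swap (lo j) (hi j) =
      (w ∘ Equiv.swap (lo j) (hi j)) ∘ Equiv.swap (lo i) (hi i) := by
  obtain ⟨h1, h2, h3, h4⟩ := ne_of_one_lt_abs hij
  funext k
  simp only [Function.comp, Equiv.swap_apply_def]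
  grind

theorem swap_braid {X : Type*} {i j : Fin (n - 1)} (hij : (j : ℕ) = (i : ℕ) + 1)
    (w : Fin n → X) :
    ((w ∘ Equiv.swap (lo i) (hi i)) ∘ Equiv.swap (lo j) (hi j)) ∘ Equiv.swap (lo i) (hi i) =
      ((w ∘ Equiv.swap (lo j) (hi j)) ∘ Equiv.swap (lo i) (hi i)) ∘
        Equiv.swap (lo j) (hi j) := by
  have h1 := lo_ne_hi_of_succ hij
  have h2 := lo_ne_hi i
  have h3 := lo_ne_hi j
  rw [hi_eq_lo_of_succ hij] at *
  funext k
  simp only [Function.comp, Equiv.swap_apply_def]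
  grind

theorem comp_swap_comp_swap {X : Type*} (w : Fin n → X) (a b : Fin n) :
    (w ∘ Equiv.swap a b) ∘ Equiv.swap a b = w := by
  funext k
  simp

end Swaps

section Relations

variable {A : Type*} [CommRing A] {r n : ℕ}

theorem opGi_comm (q : Aˣ) {i j : Fin (n - 1)} (hij : 1 < |((i : ℕ) : ℤ) - ((j : ℕ) : ℤ)|) :
    opGi r n q i * opGi r n q j = opGi r n q j * opGi r n q i := by
  obtain ⟨h1, h2, h3, h4⟩ := ne_of_one_lt_abs hij
  refine (basisTensor A r n).ext fun w => ?_
  simp only [Module.End.mul_apply, opGi_basisTensor, map_add, map_smul, Function.comp_apply,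
    Equiv.swap_apply_of_ne_of_ne h1 h2, Equiv.swap_apply_of_ne_of_ne h3 h4,
    Equiv.swap_apply_of_ne_of_ne h1.symm h3.symm, Equiv.swap_apply_of_ne_of_ne h2.symm h4.symm,
    swap_comm_of_one_lt_abs hij]
  module

theorem opGi_braid (q : Aˣ) {i j : Fin (n - 1)} (hij : (j : ℕ) = (i : ℕ) + 1) :
    opGi r n q i * opGi r n q j * opGi r n q i = opGi r n q j * opGi r n q i * opGi r n q j := by
  have h1 := lo_ne_hi_of_succ hij
  have h2 := lo_ne_hi i
  have h3 := lo_ne_hi j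
  have hb := fun w : Fin n → Fin n × Fin r => swap_braid hij w
  have hlo := hi_eq_lo_of_succ hij
  rw [hlo] at h2 hb
  refine (basisTensor A r n).ext fun w => ?_
  -- Up to `ring`, the nontrivial coefficients are those of `w` and of its two neighbour swaps.
  have e₁ := stayCoeff_braid q (w (lo i)) (w (lo j)) (w (hi j))
  have e₂ := stayCoeff_braid_left q (w (lo i)) (w (lo j)) (w (hi j))
  have e₃ := stayCoeff_braid_right q (w (lo i)) (w (lo j)) (w (hi j))
  simp only [Module.End.mul_apply, opGi_basisTensor, map_add, map_smul, Function.comp_apply, hlo,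
    Equiv.swap_apply_left, Equiv.swap_apply_right, Equiv.swap_apply_of_ne_of_ne h1.symm h3.symm,
    Equiv.swap_apply_of_ne_of_ne h2 h1, comp_swap_comp_swap, hb]
  match_scalars
  · linear_combination e₁
  · linear_combination e₂
  · linear_combination e₃
  all_goals ring

theorem opGi_mul_opTi (q : Aˣ) (ξ : A) (i : Fin (n - 1)) (j : Fin n) :
    opGi r n q i * opTi r n ξ j = opTi r n ξ (Equiv.swap (lo i) (hi i) j) * opGi r n q i := by
  refine (basisTensor A r n).ext fun w => ?_
  simp only [Module.End.mul_apply, opGi_basisTensor, opTi_basisTensor, map_add, map_smul,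
    Function.comp_apply, Equiv.swap_apply_self]
  by_cases hc : (w (lo i)).2 = (w (hi i)).2
  · have : (w (Equiv.swap (lo i) (hi i) j)).2 = (w j).2 := by
      rw [Equiv.swap_apply_def]
      split_ifs with h h' <;> simp_all
    rw [this]
    module
  · rw [stayCoeff_of_ne _ _ _ hc]
    module

theorem opGi_sq (q : Aˣ) {ξ c : A} (hξ : IsSeparatedRoot r ξ) (hc : c * r = 1)
    (i : Fin (n - 1)) :
    opGi r n q i ^ 2 = 1 + ((q : A) - (q⁻¹ : Aˣ)) • (opGi r n q i *
      (c • ∑ s ∈ Finset.range r, opTi r n ξ (hi i) ^ (r - s) * opTi r n ξ (lo i) ^ s)) := by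
  refine (basisTensor A r n).ext fun w => ?_
  have he : (c • ∑ s ∈ Finset.range r, opTi r n ξ (hi i) ^ (r - s) * opTi r n ξ (lo i) ^ s)
      (basisTensor A r n w) = (if (w (lo i)).2 = (w (hi i)).2 then (1 : A) else 0) •
        basisTensor A r n w := by
    simp only [LinearMap.smul_apply, LinearMap.sum_apply, Module.End.mul_apply,
      opTi_pow_basisTensor, map_smul, smul_smul, ← Finset.sum_smul, hξ.sum_pow_mul_pow, mul_ite,
      hc, mul_zero]
  rw [LinearMap.add_apply, LinearMap.smul_apply, Module.End.mul_apply _ (c • _), he, sq]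
  simp only [Module.End.mul_apply, opGi_basisTensor, map_add, map_smul, Function.comp_apply,
    Equiv.swap_apply_left, Equiv.swap_apply_right, comp_swap_comp_swap, Module.End.one_apply]
  split_ifs with h
  · match_scalars
    · linear_combination stayCoeff_quadratic q _ _ h
    · linear_combination stayCoeff_quadratic_swap q _ _ h
  · rw [stayCoeff_of_ne _ _ _ h, stayCoeff_of_ne _ _ _ (Ne.symm h), swapCoeff_of_ne _ _ h,
      swapCoeff_of_ne _ _ (Ne.symm h)]
    module

/-- The operators `𝐆_i` and `𝐓_j`, acting on the right, satisfy the Yokonuma-Hecke relations. -/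
theorem isYokonumaFamily_op (q : Aˣ) {ξ c : A} (hξ : IsSeparatedRoot r ξ) (hc : c * r = 1) :
    IsYokonumaFamily (B := RightEnd A r n) r q c
      (fun i => MulOpposite.op (opGi r n q i)) (fun j => MulOpposite.op (opTi r n ξ j)) where
  t_pow j := by
    rw [← MulOpposite.op_pow, ← MulOpposite.op_one]
    congr 1
    refine (basisTensor A r n).ext fun w => ?_
    rw [opTi_pow_basisTensor, ← pow_mul, mul_comm, pow_mul, hξ.pow_eq_one]
    simp
  t_comm i j := by
    simp only [← MulOpposite.op_mul]
    congr 1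
    refine (basisTensor A r n).ext fun w => ?_
    simp only [Module.End.mul_apply, opTi_basisTensor, map_smul]
    module
  t_g i j := by
    simp only [← MulOpposite.op_mul, opGi_mul_opTi]
  g_comm i j hij := by
    simp only [← MulOpposite.op_mul, opGi_comm q hij]
  braid i j hij := by
    simp only [← MulOpposite.op_mul, ← mul_assoc, opGi_braid q hij]
  quadratic i := by
    rw [← MulOpposite.op_pow, opGi_sq q hξ hc i]
    simp only [MulOpposite.op_add, MulOpposite.op_one, MulOpposite.op_smul, MulOpposite.op_mul,
      MulOpposite.op_pow, Finset.op_sum]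

end Relations

/-! ### The elements `g_σ` -/

section GWord

variable {B : Type*} [Monoid B] {n : ℕ}

/-- Undoing an ascent lowers the moment `∑ k σ(k)`, which makes the recursion for `g_σ` end. -/
theorem sum_mul_comp_swap_lt {σ : Fin n → Fin n} {i : Fin (n - 1)} (h : σ (lo i) < σ (hi i)) :
    ∑ k : Fin n, (k : ℕ) * ((σ ∘ Equiv.swap (lo i) (hi i)) k : ℕ) <
      ∑ k : Fin n, (k : ℕ) * (σ k : ℕ) := by
  have hne := lo_ne_hi i
  have hmem : hi i ∈ Finset.univ.erase (lo i) := by simp [hne.symm]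
  rw [← Finset.add_sum_erase _ _ (Finset.mem_univ (lo i)), ← Finset.add_sum_erase _ _ hmem,
    ← Finset.add_sum_erase (a := lo i) _ (fun k : Fin n => (k : ℕ) * (σ k : ℕ)) (Finset.mem_univ _),
    ← Finset.add_sum_erase _ (fun k : Fin n => (k : ℕ) * (σ k : ℕ)) hmem, ← add_assoc, ← add_assoc]
  have hs : ∑ k ∈ (Finset.univ.erase (lo i)).erase (hi i),
      (k : ℕ) * ((σ ∘ Equiv.swap (lo i) (hi i)) k : ℕ) =
      ∑ k ∈ (Finset.univ.erase (lo i)).erase (hi i), (k : ℕ) * (σ k : ℕ) := by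
    refine Finset.sum_congr rfl fun k hk => ?_
    simp only [Finset.mem_erase] at hk
    rw [Function.comp_apply, Equiv.swap_apply_of_ne_of_ne hk.2.1 hk.1]
  rw [hs]
  refine Nat.add_lt_add_right ?_ _
  simp only [Function.comp_apply, Equiv.swap_apply_left, Equiv.swap_apply_right]
  have : ((hi i : Fin n) : ℕ) = (lo i : Fin n) + 1 := rfl
  rw [this]
  have : (σ (lo i) : ℕ) < σ (hi i) := h
  nlinarith

open Classical in
/-- The element `g_σ` attached to a word `σ` in the letters `1, …, n`: the product of the `g_i`
along a sequence of neighbour transpositions that sorts a weakly decreasing word into `σ`, each of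
them producing an ascent `σ i < σ (i + 1)`. The ascent that is undone first is a choice. -/
def gWord (G : Fin (n - 1) → B) (σ : Fin n → Fin n) : B :=
  if h : ∃ i, σ (lo i) < σ (hi i) then
    gWord G (σ ∘ Equiv.swap (lo h.choose) (hi h.choose)) * G h.choose
  else 1
termination_by ∑ k : Fin n, (k : ℕ) * (σ k : ℕ)
decreasing_by exact sum_mul_comp_swap_lt h.choose_spec

theorem gWord_eq_one (G : Fin (n - 1) → B) {σ : Fin n → Fin n}
    (h : ∀ i, ¬ σ (lo i) < σ (hi i)) : gWord G σ = 1 := by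
  rw [gWord, dif_neg (by simpa using h)]

/-- The diamond lemma: by the braid relations, `g_σ` does not depend on the ascent that is
undone first. -/
theorem gWord_eq_mul (G : Fin (n - 1) → B)
    (hcomm : ∀ i j : Fin (n - 1), 1 < |((i : ℕ) : ℤ) - ((j : ℕ) : ℤ)| → G i * G j = G j * G i)
    (hbraid : ∀ i j : Fin (n - 1), (j : ℕ) = (i : ℕ) + 1 →
      G i * G j * G i = G j * G i * G j)
    (σ : Fin n → Fin n) (i : Fin (n - 1)) (hasc : σ (lo i) < σ (hi i)) :
    gWord G σ = gWord G (σ ∘ Equiv.swap (lo i) (hi i)) * G i := by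
  induction hm : ∑ k : Fin n, (k : ℕ) * (σ k : ℕ) using Nat.strong_induction_on
    generalizing σ i with
  | _ m ih =>
    subst hm
    -- For `j = i + 1`, peeling off `i` and peeling off `j` agree when both are ascents: the letters
    -- `x < y < z` can be sorted into `z, y, x` along either side of the braid relation.
    have adj : ∀ i j : Fin (n - 1), (j : ℕ) = (i : ℕ) + 1 → σ (lo i) < σ (hi i) →
        σ (lo j) < σ (hi j) →
        gWord G (σ ∘ Equiv.swap (lo i) (hi i)) * G i =
          gWord G (σ ∘ Equiv.swap (lo j) (hi j)) * G j := by
      intro i j hij hasc hj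
      have h1 := lo_ne_hi_of_succ hij
      have hlo := hi_eq_lo_of_succ hij
      have hasc' : σ (lo i) < σ (lo j) := hlo ▸ hasc
      have e₁ : Equiv.swap (lo i) (lo j) (hi j) = hi j :=
        Equiv.swap_apply_of_ne_of_ne h1.symm (lo_ne_hi j).symm
      have e₂ : Equiv.swap (lo j) (hi j) (lo i) = lo i :=
        Equiv.swap_apply_of_ne_of_ne (hlo ▸ lo_ne_hi i) h1
      have hii := sum_mul_comp_swap_lt hasc
      have hjj := sum_mul_comp_swap_lt hj
      have hb := swap_braid hij σ
      have a1 : (σ ∘ Equiv.swap (lo i) (hi i)) (lo j) <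
          (σ ∘ Equiv.swap (lo i) (hi i)) (hi j) := by
        simpa [hlo, e₁] using hasc'.trans hj
      have a2 : ((σ ∘ Equiv.swap (lo i) (hi i)) ∘
          Equiv.swap (lo j) (hi j)) (lo i) <
          ((σ ∘ Equiv.swap (lo i) (hi i)) ∘
          Equiv.swap (lo j) (hi j)) (hi i) := by
        simpa [hlo, e₁, e₂] using hj
      have b1 : (σ ∘ Equiv.swap (lo j) (hi j)) (lo i) <
          (σ ∘ Equiv.swap (lo j) (hi j)) (hi i) := by
        simpa [hlo, e₂] using hasc'.trans hj
      have b2 : ((σ ∘ Equiv.swap (lo j) (hi j)) ∘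
          Equiv.swap (lo i) (hi i)) (lo j) <
          ((σ ∘ Equiv.swap (lo j) (hi j)) ∘
          Equiv.swap (lo i) (hi i)) (hi j) := by
        simpa [hlo, e₁, e₂] using hasc'
      have hii' := (sum_mul_comp_swap_lt a1).trans hii
      have hjj' := (sum_mul_comp_swap_lt b1).trans hjj
      rw [ih _ hii _ j a1 rfl, ih _ hii' _ i a2 rfl, ih _ hjj _ i b1 rfl, ih _ hjj' _ j b2 rfl,
        hb, mul_assoc, mul_assoc, mul_assoc, mul_assoc, ← mul_assoc (G i), hbraid i j hij,
        mul_assoc]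
    have hex : ∃ i, σ (lo i) < σ (hi i) := ⟨i, hasc⟩
    rw [gWord, dif_pos hex]
    have hj := hex.choose_spec
    generalize hex.choose = j at hj
    by_cases hij : 1 < |((i : ℕ) : ℤ) - ((j : ℕ) : ℤ)|
    · obtain ⟨h1, h2, h3, h4⟩ := ne_of_one_lt_abs hij
      rw [ih _ (sum_mul_comp_swap_lt hj) _ i (by
          simpa [Equiv.swap_apply_of_ne_of_ne h1 h2, Equiv.swap_apply_of_ne_of_ne h3 h4] using hasc)
          rfl,
        ih _ (sum_mul_comp_swap_lt hasc) _ j (by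
          simpa [Equiv.swap_apply_of_ne_of_ne h1.symm h3.symm,
            Equiv.swap_apply_of_ne_of_ne h2.symm h4.symm] using hj) rfl,
        swap_comm_of_one_lt_abs hij, mul_assoc, mul_assoc, hcomm i j hij]
    · rw [lt_abs, not_or] at hij
      rcases lt_trichotomy (i : ℕ) (j : ℕ) with h | h | h
      · exact (adj i j (by omega) hasc hj).symm
      · rw [Fin.ext h]
      · exact adj j i (by omega) hj hasc

end GWord

/-! ### Colour idempotents -/

section Colour

variable {A B : Type*} [CommRing A] [Semiring B] [Algebra A B] {r : ℕ}

/-- For `τ ^ r = 1` and `c = r⁻¹`, the projection onto the eigenspace of `τ` for `ξ ^ a`,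
namely `r⁻¹ ∑ₛ ξ ^ (-a s) τ ^ s`. -/
def colourProj (c ξ : A) (τ : B) (a : Fin r) : B :=
  c • ∑ s ∈ Finset.range r, (ξ ^ (a : ℕ)) ^ (r - s) • τ ^ s

variable {c ξ : A}

theorem colourProj_mul (hξ : ξ ^ r = 1) {τ : B} (hτ : τ ^ r = 1) (a : Fin r) :
    colourProj c ξ τ a * τ = ξ ^ (a : ℕ) • colourProj c ξ τ a := by
  have hpow : (ξ ^ (a : ℕ)) ^ r = 1 := by rw [← pow_mul, mul_comm, pow_mul, hξ, one_pow]
  rw [colourProj, smul_mul_assoc, smul_comm]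
  congr 1
  obtain ⟨m, rfl⟩ : ∃ m, r = m + 1 := ⟨r - 1, by have := a.2; omega⟩
  rw [Finset.sum_mul, Finset.smul_sum, Finset.sum_range_succ, Finset.sum_range_succ']
  congr 1
  · refine Finset.sum_congr rfl fun s hs => ?_
    have : m + 1 - s = (m + 1 - (s + 1)) + 1 := by have := Finset.mem_range.1 hs; omega
    rw [smul_mul_assoc, ← pow_succ, smul_smul, this, ← pow_succ']
  · rw [smul_mul_assoc, ← pow_succ, hτ, Nat.sub_zero, hpow]
    simp

theorem sum_colourProj (hξ : IsSeparatedRoot r ξ) (hc : c * r = 1) (hr : 0 < r) (τ : B) :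
    ∑ a : Fin r, colourProj c ξ τ a = 1 := by
  simp only [colourProj]
  rw [← Finset.smul_sum, Finset.sum_comm, Finset.sum_eq_single_of_mem 0 (by simpa using hr)]
  · simp only [pow_zero, ← Finset.sum_smul, Nat.sub_zero, smul_smul]
    rw [Finset.sum_congr rfl (g := fun _ => (1 : A))]
    · simp [hc]
    · intro a _
      rw [← pow_mul, mul_comm, pow_mul, hξ.pow_eq_one, one_pow]
  · intro s hs hs0
    have := Finset.mem_range.1 hs
    rw [← Finset.sum_smul, hξ.sum_pow (by omega) (by omega), zero_smul]

theorem colourProj_mul_of_semiconj {τ τ' g : B} (h : τ * g = g * τ') (a : Fin r) :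
    colourProj c ξ τ a * g = g * colourProj c ξ τ' a := by
  have h' : SemiconjBy g τ' τ := h.symm
  simp only [colourProj, smul_mul_assoc, mul_smul_comm, Finset.sum_mul, Finset.mul_sum,
    (h'.pow_right _).eq]

variable {n : ℕ} {q : Aˣ} {G : Fin (n - 1) → B} {T : Fin n → B}

open scoped IsMulCommutative in
/-- The joint eigenprojections `E d` of the commuting elements `T j`: the product over `j` of the
projections onto the eigenspaces of `T j` for `ξ ^ d j`. They sum up to `1` and are permuted by
the `G i`. -/
theorem IsYokonumaFamily.exists_colour (h : IsYokonumaFamily r q c G T)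
    (hξ : IsSeparatedRoot r ξ) (hc : c * r = 1) (hr : 0 < r) :
    ∃ E : (Fin n → Fin r) → B,
      (∀ d j, E d * T j = ξ ^ (d j : ℕ) • E d) ∧
      (∀ d j, T j * E d = ξ ^ (d j : ℕ) • E d) ∧
      (∀ d i, E d * G i = G i * E (d ∘ Equiv.swap (lo i) (hi i))) ∧
      ∑ d, E d = 1 := by
  classical
  -- The product is formed in the commutative subalgebra generated by the `T j`.
  have : IsMulCommutative (Algebra.adjoin A (Set.range T)) :=
    Algebra.isMulCommutative_adjoin A (by
      rintro _ ⟨i, rfl⟩ _ ⟨j, rfl⟩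
      exact h.t_comm i j)
  let τ : Fin n → Algebra.adjoin A (Set.range T) :=
    fun j => ⟨T j, Algebra.subset_adjoin ⟨j, rfl⟩⟩
  have hτ : ∀ j, τ j ^ r = 1 := fun j => Subtype.ext (h.t_pow j)
  let E : (Fin n → Fin r) → Algebra.adjoin A (Set.range T) :=
    fun d => ∏ j, colourProj c ξ (τ j) (d j)
  have hE : ∀ d j, E d * τ j = ξ ^ (d j : ℕ) • E d := by
    intro d j
    simp only [E]
    rw [← Finset.mul_prod_erase _ _ (Finset.mem_univ j), mul_right_comm,
      colourProj_mul hξ.pow_eq_one (hτ j), smul_mul_assoc]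
  have hcoe : ∀ j a, ((colourProj c ξ (τ j) a : Algebra.adjoin A (Set.range T)) : B) =
      colourProj (r := r) c ξ (T j) a := by
    intro j a
    simp [colourProj, τ]
  refine ⟨fun d => E d, fun d j => ?_, fun d j => ?_, fun d i => ?_, ?_⟩
  · exact congrArg Subtype.val (hE d j)
  · have := hE d j
    rw [mul_comm] at this
    exact congrArg Subtype.val this
  · have key : ∀ S : Finset (Fin n),
        ((∏ j ∈ S, colourProj c ξ (τ j) (d j) : Algebra.adjoin A (Set.range T)) : B) * G i =
        G i * ((∏ j ∈ S, colourProj c ξ (τ (Equiv.swap (lo i) (hi i) j)) (d j) :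
          Algebra.adjoin A (Set.range T)) : B) := by
      intro S
      induction S using Finset.induction_on with
      | empty => simp
      | insert j S hj ih =>
        rw [Finset.prod_insert hj, Finset.prod_insert hj]
        change ((colourProj c ξ (τ j) (d j) : Algebra.adjoin A (Set.range T)) : B) * _ * _ =
          _ * (((colourProj c ξ _ (d j) : Algebra.adjoin A (Set.range T)) : B) * _)
        rw [mul_assoc, ih, ← mul_assoc, ← mul_assoc, hcoe, hcoe,
          colourProj_mul_of_semiconj (h.t_g i j)]
    have := key Finset.univ
    rw [← Equiv.prod_comp (Equiv.swap (lo i) (hi i))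
      (fun j => colourProj c ξ (τ (Equiv.swap (lo i) (hi i) j)) (d j))] at this
    simpa [E] using this
  · have : ∑ d, E d = 1 := by
      simp only [E]
      rw [← Fintype.prod_sum fun (j : Fin n) (a : Fin r) => colourProj c ξ (τ j) a]
      simp only [sum_colourProj hξ hc hr, Finset.prod_const_one]
    have := congrArg Subtype.val this
    simpa using this

end Colour

/-! ### Faithfulness -/

section Faithful

variable {A B : Type*} [CommRing A] [Semiring B] [Algebra A B] {r n : ℕ} {c ξ : A} {q : Aˣ}
  {G : Fin (n - 1) → B} {T : Fin n → B}

open Classical in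
/-- The linear map from tensor space to `B` that sends the basis tensor with the positions `σ` and
the colours `d` to `g_σ E d` if the positions are distinct, and to `0` otherwise. -/
def toAlgebra (r : ℕ) (G : Fin (n - 1) → B) (E : (Fin n → Fin r) → B) :
    TensorSpace A r n →ₗ[A] B :=
  (basisTensor A r n).constr A fun w =>
    if Function.Injective (fun k => (w k).1) then
      gWord G (fun k => (w k).1) * E (fun k => (w k).2)
    else 0

theorem toAlgebra_of_injective (E : (Fin n → Fin r) → B) {w : Fin n → Fin n × Fin r}
    (hw : Function.Injective fun k => (w k).1) :
    toAlgebra r G E (basisTensor A r n w) =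
      gWord G (fun k => (w k).1) * E (fun k => (w k).2) := by
  rw [toAlgebra, Module.Basis.constr_basis, if_pos hw]

theorem toAlgebra_of_not_injective (E : (Fin n → Fin r) → B) {w : Fin n → Fin n × Fin r}
    (hw : ¬ Function.Injective fun k => (w k).1) :
    toAlgebra r G E (basisTensor A r n w) = 0 := by
  rw [toAlgebra, Module.Basis.constr_basis, if_neg hw]

/-- The idempotent `e = r⁻¹ ∑ₛ T i ^ s T j ^ (-s)` fixes `E d` if the colours of `i` and `j` agree,
and annihilates it otherwise. -/
theorem idempotent_mul_colour (hξ : IsSeparatedRoot r ξ) (hc : c * r = 1)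
    {E : (Fin n → Fin r) → B} (hE : ∀ d j, T j * E d = ξ ^ (d j : ℕ) • E d)
    (d : Fin n → Fin r) (i j : Fin n) :
    (c • ∑ s ∈ Finset.range r, T i ^ s * T j ^ (r - s)) * E d =
      if d i = d j then E d else 0 := by
  have hp : ∀ j s, T j ^ s * E d = (ξ ^ (d j : ℕ)) ^ s • E d := by
    intro j s
    induction s with
    | zero => simp
    | succ s ih => rw [pow_succ, mul_assoc, hE, mul_smul_comm, ih, smul_smul, pow_succ']
  simp only [smul_mul_assoc, Finset.sum_mul, mul_assoc, hp, mul_smul_comm, smul_smul]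
  rw [← Finset.sum_smul, smul_smul]
  have := hξ.sum_pow_mul_pow (d i) (d j)
  simp only [mul_comm] at this hc ⊢
  rw [this]
  split_ifs <;> simp [hc]

/-- The map `toAlgebra` intertwines `𝐆_i` with right multiplication by `G i`. -/
theorem IsYokonumaFamily.toAlgebra_opGi (h : IsYokonumaFamily r q c G T)
    (hξ : IsSeparatedRoot r ξ) (hc : c * r = 1) {E : (Fin n → Fin r) → B}
    (hTE : ∀ d j, T j * E d = ξ ^ (d j : ℕ) • E d)
    (hEG : ∀ d i, E d * G i = G i * E (d ∘ Equiv.swap (lo i) (hi i)))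
    (i : Fin (n - 1)) (m : TensorSpace A r n) :
    toAlgebra r G E (opGi r n q i m) = toAlgebra r G E m * G i := by
  suffices H : toAlgebra r G E ∘ₗ opGi r n q i =
      LinearMap.mulRight A (G i) ∘ₗ toAlgebra r G E from LinearMap.congr_fun H m
  refine (basisTensor A r n).ext fun w => ?_
  rw [LinearMap.comp_apply, LinearMap.comp_apply, LinearMap.mulRight_apply, opGi_basisTensor,
    map_add, map_smul, map_smul]
  have hinj : (Function.Injective fun k => ((w ∘ Equiv.swap (lo i) (hi i)) k).1) ↔
      Function.Injective fun k => (w k).1 :=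
    Function.Injective.of_comp_iff' (fun k => (w k).1) (Equiv.swap (lo i) (hi i)).bijective
  by_cases hw : Function.Injective fun k => (w k).1
  swap
  · rw [toAlgebra_of_not_injective E hw, toAlgebra_of_not_injective E (mt hinj.1 hw)]
    simp
  rw [toAlgebra_of_injective E hw, toAlgebra_of_injective E (hinj.2 hw)]
  set σ : Fin n → Fin n := fun k => (w k).1
  set d : Fin n → Fin r := fun k => (w k).2
  change stayCoeff q (w (lo i)) (w (hi i)) • (gWord G σ * E d) +
    swapCoeff A (w (lo i)) (w (hi i)) • (gWord G (σ ∘ Equiv.swap (lo i) (hi i)) *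
      E (d ∘ Equiv.swap (lo i) (hi i))) = gWord G σ * E d * G i
  have hne : (w (lo i)).1 ≠ (w (hi i)).1 := fun h => lo_ne_hi i (hw h)
  have hswap : swapCoeff A (w (lo i)) (w (hi i)) = 1 := by
    simp [swapCoeff, hne]
  rw [hswap, one_smul]
  rcases lt_or_gt_of_ne hne with hlt | hgt
  · -- At an ascent, `g_σ` ends in `G i`, and the quadratic relation reduces `G i ^ 2`.
    rw [gWord_eq_mul G h.g_comm h.braid σ i hlt]
    generalize gWord G (σ ∘ Equiv.swap (lo i) (hi i)) = P
    have hquad : G i * (E d * G i) = E (d ∘ Equiv.swap (lo i) (hi i)) +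
        ((q : A) - (q⁻¹ : Aˣ)) • if d (lo i) = d (hi i) then E d * G i else 0 := by
      rw [hEG, ← mul_assoc, ← sq, h.quadratic, add_mul, one_mul, smul_mul_assoc, mul_assoc,
        ← hEG, ← mul_assoc, idempotent_mul_colour hξ hc hTE]
      split_ifs <;> simp
    rw [mul_assoc, mul_assoc, mul_assoc (G i), hquad]
    by_cases hcol : d (lo i) = d (hi i)
    · have hstay : stayCoeff q (w (lo i)) (w (hi i)) = (q : A) - (q⁻¹ : Aˣ) := by
        have : ¬ (w (lo i)).2 ≠ (w (hi i)).2 := not_not.2 hcol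
        simp [stayCoeff, hne, this, hlt.not_gt]
      have hds : d ∘ Equiv.swap (lo i) (hi i) = d := by
        funext k
        simp only [Function.comp_apply, Equiv.swap_apply_def]
        split_ifs <;> simp_all
      rw [hstay, if_pos hcol, hEG, hds, mul_add, mul_smul_comm, add_comm]
    · rw [stayCoeff_of_ne _ _ _ hcol, if_neg hcol]
      simp
  · have hstay : stayCoeff q (w (lo i)) (w (hi i)) = 0 := by
      simp [stayCoeff, hne, hgt]
    have hasc : (σ ∘ Equiv.swap (lo i) (hi i)) (lo i) <
        (σ ∘ Equiv.swap (lo i) (hi i)) (hi i) := by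
      simpa using hgt
    rw [hstay, zero_smul, zero_add, gWord_eq_mul G h.g_comm h.braid _ i hasc,
      comp_swap_comp_swap, mul_assoc, mul_assoc, hEG]

theorem toAlgebra_opTi {E : (Fin n → Fin r) → B}
    (hET : ∀ d j, E d * T j = ξ ^ (d j : ℕ) • E d) (j : Fin n) (m : TensorSpace A r n) :
    toAlgebra r G E (opTi r n ξ j m) = toAlgebra r G E m * T j := by
  suffices H : toAlgebra r G E ∘ₗ opTi r n ξ j =
      LinearMap.mulRight A (T j) ∘ₗ toAlgebra r G E from LinearMap.congr_fun H m
  refine (basisTensor A r n).ext fun w => ?_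
  rw [LinearMap.comp_apply, LinearMap.comp_apply, LinearMap.mulRight_apply, opTi_basisTensor,
    map_smul]
  by_cases hw : Function.Injective fun k => (w k).1
  · rw [toAlgebra_of_injective E hw, mul_assoc, hET, mul_smul_comm]
  · rw [toAlgebra_of_not_injective E hw]
    simp

/-- The sum over all colourings `d` of the basis tensors with the positions `n, n - 1, …, 1` is
sent to `1`, because no ascent occurs. -/
theorem toAlgebra_sum_rev {E : (Fin n → Fin r) → B} (hE : ∑ d, E d = 1) :
    toAlgebra r G E (∑ d : Fin n → Fin r, basisTensor A r n fun k => (Fin.rev k, d k)) = 1 := by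
  rw [map_sum, ← hE]
  refine Finset.sum_congr rfl fun d _ => ?_
  rw [toAlgebra_of_injective E Fin.rev_injective, gWord_eq_one, one_mul]
  intro i
  simp only [lo, hi, Fin.lt_def, Fin.val_rev]
  omega

/-- A right action on tensor space by the operators `𝐆_i` and `𝐓_j`, of an algebra generated by
elements that satisfy the Yokonuma-Hecke relations, is faithful: the orbit map of
`∑ d, v_n^{d 1} ⊗ ⋯ ⊗ v_1^{d n}` has the left inverse `toAlgebra`. -/
theorem IsYokonumaFamily.injective_of_adjoin_eq_top (h : IsYokonumaFamily r q c G T)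
    (hξ : IsSeparatedRoot r ξ) (hc : c * r = 1) (hr : 0 < r)
    (hgen : Algebra.adjoin A (Set.range G ∪ Set.range T) = ⊤) (ρ : B →ₐ[A] RightEnd A r n)
    (hρG : ∀ i, ρ (G i) = MulOpposite.op (opGi r n q i))
    (hρT : ∀ j, ρ (T j) = MulOpposite.op (opTi r n ξ j)) : Function.Injective ρ := by
  obtain ⟨E, hET, hTE, hEG, hE⟩ := h.exists_colour hξ hc hr
  have key : ∀ y m, toAlgebra r G E ((ρ y).unop m) = toAlgebra r G E m * y := by
    intro y
    have hy : y ∈ Algebra.adjoin A (Set.range G ∪ Set.range T) := hgen ▸ Algebra.mem_top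
    induction hy using Algebra.adjoin_induction with
    | mem y hy =>
      intro m
      rcases hy with ⟨i, rfl⟩ | ⟨j, rfl⟩
      · rw [hρG]
        exact h.toAlgebra_opGi hξ hc hTE hEG i m
      · rw [hρT]
        exact toAlgebra_opTi hET j m
    | algebraMap a =>
      intro m
      rw [AlgHom.commutes, MulOpposite.algebraMap_apply, MulOpposite.unop_op,
        Module.algebraMap_end_apply, map_smul, Algebra.smul_def, Algebra.commutes]
    | add y y' _ _ hy hy' =>
      intro m
      rw [map_add, MulOpposite.unop_add, LinearMap.add_apply, map_add, hy, hy', mul_add]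
    | mul y y' _ _ hy hy' =>
      intro m
      rw [map_mul, MulOpposite.unop_mul, Module.End.mul_apply, hy', hy, mul_assoc]
  intro y y' hyy
  rw [← one_mul y, ← one_mul y', ← toAlgebra_sum_rev (A := A) hE, ← key, ← key, hyy]

end Faithful

/-! ### The ground ring -/

section GroundRing

variable {r : ℕ}

theorem isPrimitiveRoot_xiComplex (hr : 0 < r) : IsPrimitiveRoot (xiComplex r) r :=
  Complex.isPrimitiveRoot_exp r hr.ne'

theorem vandermonde_xiComplex_ne_zero (hr : 0 < r) : vandermonde r (xiComplex r) ≠ 0 := by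
  rw [vandermonde, Finset.prod_ne_zero_iff]
  intro j hj
  rw [Finset.prod_ne_zero_iff]
  intro i hi
  have hij := Finset.mem_range.1 hi
  have hjr := Finset.mem_range.1 hj
  rw [sub_ne_zero]
  exact fun h => hij.ne ((isPrimitiveRoot_xiComplex hr).pow_inj (hij.trans hjr) hjr h)

/-- The root of unity `ξ` in `ℤ[ξ, r⁻¹, Δ⁻¹]`. -/
def xiCoeff (r : ℕ) : CoeffRing r :=
  ⟨xiComplex r, Algebra.subset_adjoin (by simp)⟩

theorem map_vandermonde {A A' : Type*} [CommRing A] [CommRing A'] (f : A →+* A') (x : A) :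
    f (vandermonde r x) = vandermonde r (f x) := by
  simp [vandermonde, map_prod]

theorem isSeparatedRoot_xiCoeff (hr : 0 < r) : IsSeparatedRoot r (xiCoeff r) := by
  refine .of_isUnit_vandermonde (Subtype.ext (isPrimitiveRoot_xiComplex hr).pow_eq_one) ?_
  refine IsUnit.of_mul_eq_one
    ⟨(vandermonde r (xiComplex r))⁻¹, Algebra.subset_adjoin (by simp)⟩ (Subtype.ext ?_)
  have : ((vandermonde r (xiCoeff r) : CoeffRing r) : ℂ) = vandermonde r (xiComplex r) :=
    map_vandermonde (CoeffRing r).val.toRingHom (xiCoeff r)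
  simp only [MulMemClass.coe_mul, this, OneMemClass.coe_one]
  exact mul_inv_cancel₀ (vandermonde_xiComplex_ne_zero hr)

theorem isSeparatedRoot_xiBase (hr : 0 < r) : IsSeparatedRoot r (xiBase r) :=
  (isSeparatedRoot_xiCoeff hr).map LaurentPolynomial.C

theorem rInvBase_mul (hr : 0 < r) : rInvBase r * (r : BaseRing r) = 1 := by
  have : (⟨(r : ℂ)⁻¹, Algebra.subset_adjoin (by simp)⟩ : CoeffRing r) * (r : CoeffRing r) = 1 := by
    refine Subtype.ext ?_
    have : (r : ℂ) ≠ 0 := by exact_mod_cast hr.ne'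
    simp [this]
  rw [rInvBase, ← map_natCast (LaurentPolynomial.C (R := CoeffRing r)), ← map_mul, this, map_one]

/-- In a ring in which the powers of an `r`-th root of unity are separated, it is a root of the
`r`-th cyclotomic polynomial: the factors `Φ_d`, `d < r`, of `X ^ r - 1` take unit values. -/
theorem IsSeparatedRoot.aeval_cyclotomic {A : Type*} [CommRing A] {ξ : A}
    (h : IsSeparatedRoot r ξ) (hr : 0 < r) :
    Polynomial.aeval ξ (Polynomial.cyclotomic r ℤ) = 0 := by
  have hprod := congrArg (Polynomial.aeval ξ) (Polynomial.prod_cyclotomic_eq_X_pow_sub_one hr ℤ)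
  rw [map_sub, map_pow, Polynomial.aeval_X, map_one, h.pow_eq_one, sub_self, map_prod,
    ← Finset.mul_prod_erase _ _ (Nat.mem_divisors_self r hr.ne')] at hprod
  refine (IsUnit.mul_left_eq_zero ?_).1 hprod
  rw [IsUnit.prod_iff]
  intro d hd
  rw [Finset.mem_erase, Nat.mem_divisors] at hd
  have hdr : d < r := lt_of_le_of_ne (Nat.le_of_dvd hr hd.2.1) hd.1
  have hd0 : 0 < d := Nat.pos_of_dvd_of_pos hd.2.1 hr
  have hu := h.isUnit_sub d 0 hdr hr hd0.ne'
  refine isUnit_of_dvd_unit ?_ hu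
  have := map_dvd (Polynomial.aeval ξ) (Polynomial.cyclotomic.dvd_X_pow_sub_one d ℤ)
  simpa using this

/-- Polynomial relations over `ℤ` for `exp (2 π i / r)` carry over to separated `r`-th roots of
unity, because the cyclotomic polynomial is the minimal polynomial. -/
theorem IsSeparatedRoot.aeval_eq_zero {A : Type*} [CommRing A] {ξ : A}
    (h : IsSeparatedRoot r ξ) (hr : 0 < r) {p : Polynomial ℤ}
    (hp : Polynomial.aeval (xiComplex r) p = 0) : Polynomial.aeval ξ p = 0 := by
  have hμ := isPrimitiveRoot_xiComplex hr
  have hdvd : Polynomial.cyclotomic r ℤ ∣ p := by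
    rw [Polynomial.cyclotomic_eq_minpoly hμ hr]
    exact minpoly.isIntegrallyClosed_dvd (hμ.isIntegral hr) hp
  obtain ⟨s, rfl⟩ := hdvd
  rw [map_mul, h.aeval_cyclotomic hr, zero_mul]

/-- Multiplication by a power of `r Δ` clears denominators in `ℤ[ξ, r⁻¹, Δ⁻¹]`. -/
theorem exists_pow_mul_eq_aeval {P : Type*} [CommRing P] {η a b : P} (ha : (r : P) * a = 1)
    (hb : vandermonde r η * b = 1) {z : P} (hz : z ∈ Algebra.adjoin ℤ {η, a, b}) :
    ∃ (N : ℕ) (p : Polynomial ℤ),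
      ((r : P) * vandermonde r η) ^ N * z = Polynomial.aeval η p := by
  have hv : Polynomial.aeval η (vandermonde r (Polynomial.X : Polynomial ℤ)) =
      vandermonde r η := by
    have := map_vandermonde (r := r) (Polynomial.aeval (R := ℤ) η).toRingHom Polynomial.X
    simpa using this
  have hD : Polynomial.aeval η ((r : Polynomial ℤ) * vandermonde r Polynomial.X) =
      r * vandermonde r η := by
    rw [map_mul, hv, map_natCast]
  induction hz using Algebra.adjoin_induction with
  | mem z hz =>
    rcases hz with rfl | rfl | rfl
    · exact ⟨0, Polynomial.X, by simp⟩
    · refine ⟨1, vandermonde r Polynomial.X, ?_⟩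
      rw [hv]
      linear_combination vandermonde r η * ha
    · refine ⟨1, r, ?_⟩
      rw [map_natCast]
      linear_combination (r : P) * hb
  | algebraMap m => exact ⟨0, Polynomial.C m, by simp⟩
  | add y z _ _ hy hz =>
    obtain ⟨N, p, hp⟩ := hy
    obtain ⟨M, s, hs⟩ := hz
    refine ⟨N + M, ((r : Polynomial ℤ) * vandermonde r Polynomial.X) ^ M * p +
      ((r : Polynomial ℤ) * vandermonde r Polynomial.X) ^ N * s, ?_⟩
    rw [map_add, map_mul _ (_ ^ M), map_mul _ (_ ^ N), ← hp, ← hs, map_pow, map_pow, hD]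
    ring
  | mul y z _ _ hy hz =>
    obtain ⟨N, p, hp⟩ := hy
    obtain ⟨M, s, hs⟩ := hz
    refine ⟨N + M, p * s, ?_⟩
    rw [map_mul, ← hp, ← hs]
    ring

/-- The ring homomorphism `ℤ[ξ, r⁻¹, Δ⁻¹] → K` given by a separated root of unity of `K`. -/
theorem exists_coeffRing_hom {K : Type*} [CommRing K] {ξ : K} (hr : 0 < r)
    (hξ : ξ ^ r = 1) (hrK : IsUnit (r : K)) (hv : IsUnit (vandermonde r ξ)) :
    ∃ f : CoeffRing r →+* K, f (xiCoeff r) = ξ := by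
  have hr0 : (r : ℂ) ≠ 0 := by exact_mod_cast hr.ne'
  have hv0 := vandermonde_xiComplex_ne_zero hr
  obtain ⟨a, ha⟩ := hrK.exists_right_inv
  obtain ⟨b, hb⟩ := hv.exists_right_inv
  -- The graph of the homomorphism is a subring of `ℂ × K`, generated by three elements.
  let Γ : Subalgebra ℤ (ℂ × K) := Algebra.adjoin ℤ
    {(xiComplex r, ξ), ((r : ℂ)⁻¹, a), ((vandermonde r (xiComplex r))⁻¹, b)}
  let π : Γ →ₐ[ℤ] ℂ := (AlgHom.fst ℤ ℂ K).comp Γ.val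
  have hV : vandermonde r ((xiComplex r, ξ) : ℂ × K) =
      (vandermonde r (xiComplex r), vandermonde r ξ) :=
    Prod.ext (map_vandermonde (RingHom.fst ℂ K) _) (map_vandermonde (RingHom.snd ℂ K) _)
  have hinj : Function.Injective π := by
    rw [injective_iff_map_eq_zero]
    rintro ⟨⟨x, k⟩, hz⟩ hx
    change x = 0 at hx
    subst hx
    obtain ⟨N, p, hp⟩ := exists_pow_mul_eq_aeval (r := r)
      (Prod.ext (mul_inv_cancel₀ hr0) ha) (hV ▸ Prod.ext (mul_inv_cancel₀ hv0) hb) hz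
    have h₁ := congrArg (AlgHom.fst ℤ ℂ K) hp
    have h₂ := congrArg (AlgHom.snd ℤ ℂ K) hp
    rw [← Polynomial.aeval_algHom_apply] at h₁ h₂
    simp only [hV, AlgHom.fst_apply, AlgHom.snd_apply, Prod.fst_mul, Prod.snd_mul, Prod.pow_fst,
      Prod.pow_snd, mul_zero, Prod.fst_natCast, Prod.snd_natCast] at h₁ h₂
    rw [(IsSeparatedRoot.of_isUnit_vandermonde hξ hv).aeval_eq_zero hr h₁.symm] at h₂
    have hk : k = 0 := (((hrK.mul hv).pow N).mul_right_eq_zero).1 h₂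
    subst hk
    rfl
  have hle : CoeffRing r ≤ π.range := by
    refine Algebra.adjoin_le ?_
    rintro _ (rfl | rfl | rfl)
    · exact ⟨⟨(xiComplex r, ξ), Algebra.subset_adjoin (by simp)⟩, rfl⟩
    · exact ⟨⟨((r : ℂ)⁻¹, a), Algebra.subset_adjoin (by simp)⟩, rfl⟩
    · exact ⟨⟨((vandermonde r (xiComplex r))⁻¹, b), Algebra.subset_adjoin (by simp)⟩, rfl⟩
  let ε := AlgEquiv.ofInjective π hinj
  refine ⟨(((AlgHom.snd ℤ ℂ K).comp Γ.val).comp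
    (ε.symm.toAlgHom.comp (Subalgebra.inclusion hle))).toRingHom, ?_⟩
  have : Subalgebra.inclusion hle (xiCoeff r) =
      ε ⟨(xiComplex r, ξ), Algebra.subset_adjoin (by simp)⟩ := rfl
  change ((ε.symm (Subalgebra.inclusion hle (xiCoeff r)) : Γ) : ℂ × K).2 = ξ
  rw [this, AlgEquiv.symm_apply_apply]

/-- A ring homomorphism on `ℤ[ξ, r⁻¹, Δ⁻¹]` is determined by the image of `ξ`. -/
theorem coeffRing_hom_ext {K : Type*} [CommRing K] (hr : 0 < r) {f f' : CoeffRing r →+* K}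
    (h : f (xiCoeff r) = f' (xiCoeff r)) : f = f' := by
  have hr0 : (r : ℂ) ≠ 0 := by exact_mod_cast hr.ne'
  have hv0 := vandermonde_xiComplex_ne_zero hr
  -- Ring homomorphisms that agree on an element agree on its inverse.
  have hinv : ∀ {x y : CoeffRing r}, x * y = 1 → f x = f' x → f y = f' y := by
    intro x y hxy hx
    have h₁ : f x * f y = 1 := by rw [← map_mul, hxy, map_one]
    have h₂ : f' x * f' y = 1 := by rw [← map_mul, hxy, map_one]
    calc f y = f y * (f' x * f' y) := by rw [h₂, mul_one]
      _ = f' y := by rw [← hx, ← mul_assoc, mul_comm (f y), h₁, one_mul]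
  have hcoe : ((vandermonde r (xiCoeff r) : CoeffRing r) : ℂ) = vandermonde r (xiComplex r) :=
    map_vandermonde (CoeffRing r).val.toRingHom (xiCoeff r)
  suffices H : f.toIntAlgHom = f'.toIntAlgHom from
    RingHom.ext fun x => DFunLike.congr_fun H x
  refine AlgHom.adjoin_ext fun x hx => ?_
  rcases hx with rfl | rfl | rfl
  · exact h
  · refine hinv (x := (r : CoeffRing r)) (Subtype.ext ?_) (by simp)
    exact mul_inv_cancel₀ hr0
  · refine hinv (x := vandermonde r (xiCoeff r)) (Subtype.ext ?_) ?_
    · simp only [MulMemClass.coe_mul, hcoe, OneMemClass.coe_one]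
      exact mul_inv_cancel₀ hv0
    · rw [map_vandermonde, map_vandermonde, h]

/-- The universal property of the ground ring `R`. -/
theorem existsUnique_baseRing_hom {K : Type*} [CommRing K] (hr : 0 < r) (q : Kˣ) {ξ : K}
    (hξ : ξ ^ r = 1) (hrK : IsUnit (r : K)) (hv : IsUnit (vandermonde r ξ)) :
    ∃! φ : BaseRing r →+* K, φ (qBase r : BaseRing r) = q ∧ φ (xiBase r) = ξ := by
  obtain ⟨f, hf⟩ := exists_coeffRing_hom hr hξ hrK hv
  refine ⟨LaurentPolynomial.eval₂ f q, ⟨?_, ?_⟩, ?_⟩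
  · simp [qBase]
  · exact (LaurentPolynomial.eval₂_C f q _).trans hf
  · rintro φ ⟨h₁, h₂⟩
    have hC : φ.comp LaurentPolynomial.C = f := coeffRing_hom_ext hr (h₂.trans hf.symm)
    refine IsLocalization.ringHom_ext
      (Submonoid.powers (Polynomial.X : Polynomial (CoeffRing r))) (Polynomial.ringHom_ext ?_ ?_)
    · intro a
      simpa using DFunLike.congr_fun hC a
    · simpa [qBase] using h₁

end GroundRing

/-! ### The Yokonuma-Hecke algebra and its specializations -/

section Algebra

variable {A A' B B' : Type*} [CommRing A] [CommRing A'] [Semiring B] [Semiring B'] [Algebra A B]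
  [Algebra A B'] {r n : ℕ} {q : Aˣ} {c : A} {G : Fin (n - 1) → B} {T : Fin n → B}

theorem IsYokonumaFamily.map (h : IsYokonumaFamily r q c G T) (f : B →ₐ[A] B') :
    IsYokonumaFamily r q c (fun i => f (G i)) (fun j => f (T j)) where
  t_pow j := by rw [← map_pow, h.t_pow, map_one]
  t_comm i j := by rw [← map_mul, h.t_comm, map_mul]
  t_g i j := by rw [← map_mul, h.t_g, map_mul]
  g_comm i j hij := by rw [← map_mul, h.g_comm i j hij, map_mul]
  braid i j hij := by simp only [← map_mul, h.braid i j hij]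
  quadratic i := by
    rw [← map_pow, h.quadratic i]
    simp

theorem isYokonumaFamily_algebraMap_iff [Algebra A A'] [Algebra A' B] [IsScalarTower A A' B]
    {q' : A'ˣ} (hq : Units.map (algebraMap A A').toMonoidHom q = q') :
    IsYokonumaFamily r q' (algebraMap A A' c) G T ↔ IsYokonumaFamily r q c G T := by
  have hδ : (q' : A') - (q'⁻¹ : A'ˣ) = algebraMap A A' ((q : A) - (q⁻¹ : Aˣ)) := by
    rw [map_sub, ← hq, ← map_inv]
    rfl
  constructor <;> intro h <;>
    refine ⟨h.t_pow, h.t_comm, h.t_g, h.g_comm, h.braid, fun i => ?_⟩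
  · have := h.quadratic i
    rwa [hδ, algebraMap_smul, algebraMap_smul] at this
  · rw [hδ, algebraMap_smul, algebraMap_smul]
    exact h.quadratic i

theorem isYokonumaFamily_generators (r n : ℕ) :
    IsYokonumaFamily r (qBase r) (rInvBase r) (g r n) (t r n) := by
  have key := fun {a b} (h : Rel r n a b) =>
    RingQuot.mkAlgHom_rel (BaseRing r) (s := Rel r n) h
  refine ⟨fun j => ?_, fun i j => ?_, fun i j => ?_, fun i j hij => ?_, fun i j hij => ?_,
    fun i => ?_⟩
  · simpa [g, t] using key (.t_pow j)
  · simpa [g, t] using key (.t_comm i j)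
  · simpa [g, t] using key (.t_g i j)
  · simpa [g, t] using key (.g_comm i j hij)
  · simpa [g, t] using key (.braid i j hij)
  · have hq := key (.quadratic i)
    simp only [freeE, map_pow, map_add, map_one, map_smul, map_mul, map_sum] at hq
    exact hq

theorem adjoin_generators (r n : ℕ) :
    Algebra.adjoin (BaseRing r) (Set.range (g r n) ∪ Set.range (t r n)) = ⊤ := by
  have h := congrArg (Subalgebra.map (RingQuot.mkAlgHom (BaseRing r) (Rel r n)))
    (FreeAlgebra.adjoin_range_ι (BaseRing r) (Gen n))
  rw [Algebra.map_top, (AlgHom.range_eq_top _).2 (RingQuot.mkAlgHom_surjective _ _),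
    AlgHom.map_adjoin] at h
  rw [eq_top_iff, ← h]
  refine Algebra.adjoin_mono ?_
  rintro _ ⟨_, ⟨i | j, rfl⟩, rfl⟩
  · exact Or.inl ⟨i, rfl⟩
  · exact Or.inr ⟨j, rfl⟩

/-- The universal property of the Yokonuma-Hecke algebra. -/
theorem exists_algHom_of_family {C : Type*} [Semiring C] [Algebra (BaseRing r) C]
    {G : Fin (n - 1) → C} {T : Fin n → C}
    (h : IsYokonumaFamily r (qBase r) (rInvBase r) G T) :
    ∃ f : Yokonuma r n →ₐ[BaseRing r] C, (∀ i, f (g r n i) = G i) ∧ ∀ j, f (t r n j) = T j := by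
  let F : FreeAlgebra (BaseRing r) (Gen n) →ₐ[BaseRing r] C :=
    FreeAlgebra.lift (BaseRing r) fun
      | .g i => G i
      | .t j => T j
  have hG : ∀ i, F (freeG r n i) = G i := fun i => FreeAlgebra.lift_ι_apply _ _
  have hT : ∀ j, F (freeT r n j) = T j := fun j => FreeAlgebra.lift_ι_apply _ _
  have hF : ∀ ⦃a b⦄, Rel r n a b → F a = F b := by
    rintro _ _ (j | ⟨i, j⟩ | ⟨i, j⟩ | ⟨i, j, hij⟩ | ⟨i, j, hij⟩ | i)
    · simpa [hT] using h.t_pow j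
    · simpa [hT] using h.t_comm i j
    · simpa [hT, hG] using h.t_g i j
    · simpa [hG] using h.g_comm i j hij
    · simpa [hG] using h.braid i j hij
    · simpa [hG, hT, freeE] using h.quadratic i
  refine ⟨RingQuot.liftAlgHom (BaseRing r) ⟨F, hF⟩, fun i => ?_, fun j => ?_⟩
  · rw [g, RingQuot.liftAlgHom_mkAlgHom_apply, hG]
  · rw [t, RingQuot.liftAlgHom_mkAlgHom_apply, hT]

theorem adjoin_one_tmul_generators (r n : ℕ) (K : Type*) [CommRing K] [Algebra (BaseRing r) K] :
    Algebra.adjoin K (Set.range (fun i => (1 : K) ⊗ₜ[BaseRing r] g r n i) ∪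
      Set.range fun j => (1 : K) ⊗ₜ[BaseRing r] t r n j) = ⊤ := by
  have h := Algebra.TensorProduct.adjoin_one_tmul_image_eq_top (A := K) _ (adjoin_generators r n)
  rwa [Set.image_union, ← Set.range_comp, ← Set.range_comp] at h

/-- The representation of the specialized Yokonuma-Hecke algebra on tensor space, and its
faithfulness. -/
theorem exists_injective_baseChange (hr : 0 < r) (K : Type*) [CommRing K]
    [Algebra (BaseRing r) K] (q : Kˣ) (ξ : K)
    (hq : algebraMap (BaseRing r) K (qBase r : BaseRing r) = q)
    (hξ : algebraMap (BaseRing r) K (xiBase r) = ξ) :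
    ∃ ρ : K ⊗[BaseRing r] Yokonuma r n →ₐ[K] RightEnd K r n,
      (∀ j : Fin n, ρ (1 ⊗ₜ[BaseRing r] t r n j) = MulOpposite.op (opTi r n ξ j)) ∧
      (∀ i : Fin (n - 1), ρ (1 ⊗ₜ[BaseRing r] g r n i) = MulOpposite.op (opGi r n q i)) ∧
      Function.Injective ρ := by
  have hsep : IsSeparatedRoot r ξ := hξ ▸ (isSeparatedRoot_xiBase hr).map (algebraMap _ K)
  have hc : algebraMap (BaseRing r) K (rInvBase r) * (r : K) = 1 := by
    rw [← map_natCast (algebraMap (BaseRing r) K), ← map_mul, rInvBase_mul hr, map_one]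
  have hq' : Units.map (algebraMap (BaseRing r) K).toMonoidHom (qBase r) = q := Units.ext hq
  obtain ⟨f, hfG, hfT⟩ := exists_algHom_of_family
    ((isYokonumaFamily_algebraMap_iff hq').1 (isYokonumaFamily_op (n := n) q hsep hc))
  let ρ : K ⊗[BaseRing r] Yokonuma r n →ₐ[K] RightEnd K r n :=
    Algebra.TensorProduct.lift (Algebra.ofId K _) f fun a y => Algebra.commutes a (f y)
  have hρ : ∀ y, ρ (1 ⊗ₜ y) = f y := fun y =>
    (Algebra.TensorProduct.lift_tmul _ _ _ _ _).trans (by rw [map_one, one_mul])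
  have hfam : IsYokonumaFamily (B := K ⊗[BaseRing r] Yokonuma r n) r q
      (algebraMap (BaseRing r) K (rInvBase r)) (fun i => 1 ⊗ₜ g r n i) (fun j => 1 ⊗ₜ t r n j) :=
    (isYokonumaFamily_algebraMap_iff hq').2
      ((isYokonumaFamily_generators r n).map Algebra.TensorProduct.includeRight)
  have hρG : ∀ i, ρ (1 ⊗ₜ g r n i) = MulOpposite.op (opGi r n q i) := fun i => by rw [hρ, hfG]
  have hρT : ∀ j, ρ (1 ⊗ₜ t r n j) = MulOpposite.op (opTi r n ξ j) := fun j => by rw [hρ, hfT]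
  exact ⟨ρ, hρT, hρG, hfam.injective_of_adjoin_eq_top hsep hc hr
    (adjoin_one_tmul_generators r n K) ρ hρG hρT⟩

end Algebra

end YokonumaHecke

end

theorem mainTheorem5 (r n : ℕ) (hr : 0 < r) (hn : 0 < n) :
    (∃ ρ : YokonumaHecke.Yokonuma r n →ₐ[YokonumaHecke.BaseRing r]
        YokonumaHecke.RightEnd (YokonumaHecke.BaseRing r) r n,
      (∀ j : Fin n, ρ (YokonumaHecke.t r n j) =
        MulOpposite.op (YokonumaHecke.opTi r n (YokonumaHecke.xiBase r) j)) ∧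
      (∀ i : Fin (n - 1), ρ (YokonumaHecke.g r n i) =
        MulOpposite.op (YokonumaHecke.opGi r n (YokonumaHecke.qBase r) i)) ∧
      Function.Injective ρ) ∧
    ∀ (K : Type*) [CommRing K] (q ξ : Kˣ), ξ ^ r = 1 → IsUnit (r : K) →
      IsUnit (YokonumaHecke.vandermonde r (ξ : K)) →
      (∃! φ : YokonumaHecke.BaseRing r →+* K,
        φ (YokonumaHecke.qBase r : YokonumaHecke.BaseRing r) = q ∧
        φ (YokonumaHecke.xiBase r) = ξ) ∧
      ∀ [Algebra (YokonumaHecke.BaseRing r) K],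
        algebraMap (YokonumaHecke.BaseRing r) K
          (YokonumaHecke.qBase r : YokonumaHecke.BaseRing r) = q →
        algebraMap (YokonumaHecke.BaseRing r) K (YokonumaHecke.xiBase r) = ξ →
        ∃ ρK : K ⊗[YokonumaHecke.BaseRing r] YokonumaHecke.Yokonuma r n →ₐ[K]
            YokonumaHecke.RightEnd K r n,
          (∀ j : Fin n, ρK (1 ⊗ₜ[YokonumaHecke.BaseRing r] YokonumaHecke.t r n j) =
            MulOpposite.op (YokonumaHecke.opTi r n (ξ : K) j)) ∧
          (∀ i : Fin (n - 1), ρK (1 ⊗ₜ[YokonumaHecke.BaseRing r] YokonumaHecke.g r n i) =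
            MulOpposite.op (YokonumaHecke.opGi r n q i)) ∧
          Function.Injective ρK := by
  have hsep := YokonumaHecke.isSeparatedRoot_xiBase hr
  have hc := YokonumaHecke.rInvBase_mul hr
  obtain ⟨ρ, hρG, hρT⟩ := YokonumaHecke.exists_algHom_of_family
    (YokonumaHecke.isYokonumaFamily_op (n := n) (YokonumaHecke.qBase r) hsep hc)
  refine ⟨⟨ρ, hρT, hρG, (YokonumaHecke.isYokonumaFamily_generators r n).injective_of_adjoin_eq_top
    hsep hc hr (YokonumaHecke.adjoin_generators r n) ρ hρG hρT⟩, ?_⟩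
  intro K _ q ξ hξ hrK hv
  refine ⟨YokonumaHecke.existsUnique_baseRing_hom hr q ?_ hrK hv, ?_⟩
  · rw [← Units.val_pow_eq_pow_val, hξ, Units.val_one]
  · intro _ hqK hξK
    exact YokonumaHecke.exists_injective_baseChange hr K q ξ hqK hξK
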